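/- Let $L$ be a finite algebraic signature (finitely many function symbols, constants allowed, no relation symbols), and let $\mathcal V$ be the variety of $L$-algebras axiomatized by a c.e. set $\Lambda$ of equational laws. For $k\ge 1$ let $X_k=\{x_0,\dots,x_{k-1}\}$, and fix an injective coding of the pairs of $L$-terms over $X_k$ by natural numbers that is computable uniformly in $k$. Let $W_e$ be the domain of the $e$-th partial computable function $\varphi_e$, and let $\langle X_k\mid W_e\rangle_{\mathcal V}$ be the quotient of the term algebra over $X_k$ by the smallest congruence that contains all pairs of terms whose code lies in $W_e$ and all substitution instances of the laws in $\Lambda$. Using a computable pairing bijection $\langle\cdot,\cdot\rangle:\mathbb N_{\ge1}\times\mathbb N\to\mathbb N$, put $\mathcal V_{f.g.}[\langle k,e\rangle]=\langle X_k\mid W_e\rangle_{\mathcal V}$, and define the isomorphism relation on indices $p,q\in\mathbb N$ by $$p\cong_{\mathcal V_{f.g.}}q\iff \mathcal V_{f.g.}[p]\cong\mathcal V_{f.g.}[q].$$ Theorem. Suppose that for every $p\in\mathbb N$ the congruence lattice of $\mathcal V_{f.g.}[p]$, ordered by inclusion, satisfies the ascending chain condition: every sequence $\theta_0\subseteq\theta_1\subseteq\theta_2\subseteq\cdots$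 of congruences is eventually constant. Then $\cong_{\mathcal V_{f.g.}}$ is computably reducible to $=^{ce}$, the equality of c.e. sets: there is a computable function $f:\mathbb N\to\mathbb N$ such that for all $p,q\in\mathbb N$ $$\mathcal V_{f.g.}[p]\cong\mathcal V_{f.g.}[q]\iff W_{f(p)}=W_{f(q)}.$$ -/

import Mathlib

universe u v w

open scoped FirstOrder

namespace CEAlg

/-! ### Computability: c.e. sets and computable reducibility -/

/-- `W e` is the domain of the `e`-th partial computable function. -/
def W (e : ℕ) : Set ℕ :=
  {x | ((Denumerable.ofNat Nat.Partrec.Code e).eval x).Dom}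

/-- The relation `=^{ce}`: equality of c.e. sets, as a relation on their indices. -/
def EqCE (e i : ℕ) : Prop := W e = W i

/-- `E ≤_c F`: computable reducibility of binary relations on `ℕ`. -/
def ComputablyReducible (E F : ℕ → ℕ → Prop) : Prop :=
  ∃ h : ℕ → ℕ, Computable h ∧ ∀ x y, E x y ↔ F (h x) (h y)

/-! ### Algebras, congruences and the ascending chain condition

A signature is a first-order language `L` without relation symbols (`L.IsAlgebraic`); an algebra
is an `L`-structure. -/

/-- A congruence relation on an algebra. -/
structure Congruence (L : FirstOrder.Language.{u, v}) (A : Type w) [L.Structure A] extends Setoid A where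
  map_rel : ∀ {n : ℕ} (f : L.Functions n) (a b : Fin n → A),
    (∀ i, r (a i) (b i)) → r (FirstOrder.Language.Structure.funMap f a) (FirstOrder.Language.Structure.funMap f b)

theorem Congruence.toSetoid_injective {L : FirstOrder.Language.{u, v}} {A : Type w} [L.Structure A] :
    Function.Injective (Congruence.toSetoid : Congruence L A → Setoid A) := by
  rintro ⟨s, hs⟩ ⟨t, ht⟩ h
  cases h
  rfl

/-- Congruences are ordered by inclusion. -/
instance {L : FirstOrder.Language.{u, v}} {A : Type w} [L.Structure A] : PartialOrder (Congruence L A) :=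
  PartialOrder.lift Congruence.toSetoid Congruence.toSetoid_injective

/-- The quotient algebra by a congruence: this makes Mathlib's `FirstOrder.Language.quotientStructure`
available on `Quotient c.toSetoid`. -/
instance Congruence.prestructure {L : FirstOrder.Language.{u, v}} [L.IsAlgebraic] {A : Type w}
    [S : L.Structure A] (c : Congruence L A) : L.Prestructure c.toSetoid where
  toStructure := S
  fun_equiv x y h := c.map_rel _ x y h
  rel_equiv {_} {r} _ _ _ := isEmptyElim r

/-- The ascending chain condition for a partially ordered set. -/
def HasACC (P : Type*) [PartialOrder P] : Prop :=
  ∀ c : ℕ → P, (∀ n, c n ≤ c (n + 1)) → ∃ n, ∀ m, n ≤ m → c m = c n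

/-! ### Terms, equational laws and presentations -/

/-- The term algebra over the set `X` of variables. -/
instance termAlgebra {L : FirstOrder.Language.{u, v}} [L.IsAlgebraic] {X : Type w} :
    L.Structure (L.Term X) where
  funMap f t := FirstOrder.Language.Term.func f t
  RelMap r _ := isEmptyElim r

/-- Identities `s ≈ t` (pairs of terms) over the set `X` of variables. -/
abbrev Identity (L : FirstOrder.Language.{u, v}) (X : Type w) := L.Term X × L.Term X

/-- A set of equational laws, in the variables `0, 1, 2, …`, is c.e. -/
def CELaws {L : FirstOrder.Language.{u, v}} [Encodable (Σ i, L.Functions i)]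
    (Λ : Set (Identity L ℕ)) : Prop :=
  REPred fun c : ℕ => ∃ p ∈ Λ, Encodable.encode p = c

/-- The relation `≈_R` on terms over `X`: the congruence generated by the identities in `R`
together with all substitution instances of the laws in `Λ`. -/
inductive Derivable {L : FirstOrder.Language.{u, v}} (Λ : Set (Identity L ℕ)) {X : Type w}
    (R : Set (Identity L X)) : L.Term X → L.Term X → Prop
  | rel {s t : L.Term X} : (s, t) ∈ R → Derivable Λ R s t
  | law {s t : L.Term ℕ} (σ : ℕ → L.Term X) : (s, t) ∈ Λ → Derivable Λ R (s.subst σ) (t.subst σ)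
  | refl (t : L.Term X) : Derivable Λ R t t
  | symm {s t : L.Term X} : Derivable Λ R s t → Derivable Λ R t s
  | trans {s t r : L.Term X} : Derivable Λ R s t → Derivable Λ R t r → Derivable Λ R s r
  | func {n : ℕ} (f : L.Functions n) (s t : Fin n → L.Term X) :
      (∀ i, Derivable Λ R (s i) (t i)) → Derivable Λ R (.func f s) (.func f t)

/-- `≈_R` as a congruence of the term algebra. -/
def presCongruence {L : FirstOrder.Language.{u, v}} [L.IsAlgebraic] (Λ : Set (Identity L ℕ)) {X : Type w}
    (R : Set (Identity L X)) : Congruence L (L.Term X) where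
  r := Derivable Λ R
  iseqv := ⟨.refl, .symm, .trans⟩
  map_rel := .func

/-- The algebra `⟨X ∣ R⟩_V` presented by the generators `X` and the identities `R` in the variety
`V` axiomatized by the laws `Λ`. -/
abbrev PresentedAlgebra {L : FirstOrder.Language.{u, v}} [L.IsAlgebraic] (Λ : Set (Identity L ℕ))
    {X : Type w} (R : Set (Identity L X)) :=
  Quotient (presCongruence Λ R).toSetoid

/-! ### Indices of c.e. presentations of finitely generated algebras -/

/-- A computable coding, uniform in `k`, of the identities over the generators
`X_k = {x_0, …, x_{k-1}}` by natural numbers. An algorithm finds the code of an identity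
from `k` and from Mathlib's (Polish notation) Gödel number of the identity. -/
structure IdentityCoding (L : FirstOrder.Language.{u, v}) [Encodable (Σ i, L.Functions i)] where
  code : ∀ k : ℕ, Identity L (Fin k) → ℕ
  injective : ∀ k, Function.Injective (code k)
  computable : ∃ g : ℕ × ℕ →. ℕ, Partrec g ∧
    ∀ (k : ℕ) (p : Identity L (Fin k)), code k p ∈ g (k, Encodable.encode p)

/-- The Gödel numbering is such a coding. -/
def IdentityCoding.goedel (L : FirstOrder.Language.{u, v}) [Encodable (Σ i, L.Functions i)] :
    IdentityCoding L where
  code _ p := Encodable.encode p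
  injective _ := Encodable.encode_injective
  computable := ⟨fun x => Part.some x.2, Computable.snd, fun _ _ => Part.mem_some _⟩

/-- The set of identities over `X_k` that the c.e. set `W e` encodes. -/
def IdentityCoding.identities {L : FirstOrder.Language.{u, v}} [Encodable (Σ i, L.Functions i)]
    (num : IdentityCoding L) (k e : ℕ) : Set (Identity L (Fin k)) :=
  {p | num.code k p ∈ W e}

/-- The algebra `V_{f.g.}[⟨k, e⟩] = ⟨X_k ∣ W_e⟩_V` with index `p = ⟨k, e⟩`. Here `k` ranges over the
positive integers, so the pairing is `⟨k, e⟩ = Nat.pair (k - 1) e`. -/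
abbrev FGAlgebra {L : FirstOrder.Language.{u, v}} [L.IsAlgebraic] [Encodable (Σ i, L.Functions i)]
    (num : IdentityCoding L) (Λ : Set (Identity L ℕ)) (p : ℕ) :=
  PresentedAlgebra Λ (num.identities (p.unpair.1 + 1) p.unpair.2)

/-- The isomorphism relation `≅_{V_{f.g.}}` on indices. -/
def FGIso {L : FirstOrder.Language.{u, v}} [L.IsAlgebraic] [Encodable (Σ i, L.Functions i)]
    (num : IdentityCoding L) (Λ : Set (Identity L ℕ)) (p q : ℕ) : Prop :=
  Nonempty (FGAlgebra num Λ p ≃[L] FGAlgebra num Λ q)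

/-- `V_{f.g.}` has ACC: the congruence lattice of each of its members satisfies the ascending
chain condition. -/
def FGHasACC {L : FirstOrder.Language.{u, v}} [L.IsAlgebraic] [Encodable (Σ i, L.Functions i)]
    (num : IdentityCoding L) (Λ : Set (Identity L ℕ)) : Prop :=
  ∀ p : ℕ, HasACC (Congruence L (FGAlgebra num Λ p))

end CEAlg

/-! To an index `p` is attached the set of all finite presentations whose algebra in the variety
maps homomorphically onto the algebra of `p`. This set is c.e. uniformly in `p`, and `f p` is an
index of the set of its codes.

The inclusion `W (f p) ⊆ W (f q)` holds iff the algebra of `p` maps onto the algebra of `q`. From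
right to left, surjections are composed. From left to right, the ascending chain condition in the
free algebra makes the algebra of `p` finitely presented (`HasACC.exists_list`): a finite part of
its relations implies the rest. This finite presentation lies in `W (f p)`, hence in `W (f q)`, and
the resulting surjection factors through the algebra of `p`.

Equality of the two sets thus means surjections in both directions. Their composite is a surjective
endomorphism, which is injective because the kernels of its iterates form an ascending chain
(`IsEpi.reflect`). So both algebras are isomorphic (`IsEpi.nonempty_equiv`).

Enumerability rests on an inference system for the valid identities. Its objects are lists of
numbers, terms in Polish notation, so that one system serves all numbers of generators
(`rePred_rule`, `inferable_tokens_iff`); the closure under c.e. rules is c.e. (`REPred.inferable`).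
-/

open Encodable

/-! ### Closure properties of c.e. predicates -/

section RecursivelyEnumerable

variable {α β : Type*} [Primcodable α] [Primcodable β]

theorem REPred.comp {p : β → Prop} (hp : REPred p) {f : α → β} (hf : Computable f) :
    REPred fun a => p (f a) :=
  Partrec.comp hp hf

theorem PrimrecPred.rePred {p : α → Prop} (hp : PrimrecPred p) : REPred p :=
  hp.computablePred.to_re

/-- A recursively enumerable predicate is the projection of a primitive recursive one. -/
theorem REPred.exists_primrecPred {p : α → Prop} (hp : REPred p) :
    ∃ q : α → ℕ → Prop, PrimrecRel q ∧ ∀ a, p a ↔ ∃ n, q a n := by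
  obtain ⟨c, hc⟩ := Nat.Partrec.Code.exists_code.1 hp
  refine ⟨fun a n => (c.evaln n (encode a)).isSome = true, ?_, fun a => ?_⟩
  · have h : Primrec fun x : α × ℕ => (c.evaln x.2 (encode x.1)).isSome :=
      Primrec.option_isSome.comp (Nat.Partrec.Code.primrec_evaln.comp
        ((Primrec.snd.pair (Primrec.const c)).pair (Primrec.encode.comp Primrec.fst)))
    exact ⟨inferInstance, h.of_eq fun x => by simp⟩
  · have h : p a ↔ (c.eval (encode a)).Dom := by
      rw [hc]; simp [Part.assert]
    rw [h, Part.dom_iff_mem]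
    simp only [Nat.Partrec.Code.evaln_complete, Option.isSome_iff_exists]
    exact exists_comm

theorem PrimrecRel.rePred_exists {q : α → ℕ → Prop} (hq : PrimrecRel q) :
    REPred fun a => ∃ n, q a n := by
  classical
  have hq : Primrec fun x : α × ℕ => decide (q x.1 x.2) := PrimrecPred.decide hq
  have h : Partrec fun a => Nat.rfind fun n => Part.some (decide (q a n)) :=
    Partrec.rfind hq.to_comp.partrec.to₂
  refine ((h.map (Computable.const ()).to₂).of_eq fun a => ?_ : Partrec _)
  apply Part.ext'
  · refine (show _ ↔ (Nat.rfind fun n => Part.some (decide (q a n))).Dom from Iff.rfl).trans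
      (Nat.rfind_dom.trans ?_)
    simp [Part.assert]
  · intros; rfl

/-- Dovetailing: one number codes both a candidate `b` and a witness for it; numbers that decode to
no candidate are rejected. -/
theorem REPred.exists {p : α → β → Prop} (hp : REPred fun x : α × β => p x.1 x.2) :
    REPred fun a => ∃ b, p a b := by
  obtain ⟨q, ⟨hd, hq⟩, h⟩ := hp.exists_primrecPred
  have hd' : ∀ a b n, Decidable (q (a, b) n) := fun a b n => hd ((a, b), n)
  let r : α → ℕ → Bool := fun a m =>
    Option.casesOn (decode (α := β) m.unpair.1) false fun b => decide (q (a, b) m.unpair.2)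
  have hr : Primrec₂ r := by
    refine Primrec.option_casesOn
      (Primrec.decode.comp (Primrec.fst.comp (Primrec.unpair.comp Primrec.snd)))
      (Primrec.const false) ?_
    refine (hq.comp (((Primrec.fst.comp Primrec.fst).pair Primrec.snd).pair
      (Primrec.snd.comp (Primrec.unpair.comp (Primrec.snd.comp Primrec.fst))))).of_eq fun x => ?_
    congr
  have hr' : PrimrecRel fun a m => r a m = true := 
    ⟨fun x => decEq (r x.1 x.2) true, 
      Primrec.of_eq (f := fun x : α × ℕ => r x.1 x.2) hr fun x => by simp⟩
  refine hr'.rePred_exists.of_eq fun a => ⟨?_, ?_⟩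
  · rintro ⟨m, hm⟩
    rcases hb : decode (α := β) m.unpair.1 with _ | b
    · simp [r, hb] at hm
    · exact ⟨b, (h (a, b)).2 ⟨m.unpair.2, by simpa [r, hb] using hm⟩⟩
  · rintro ⟨b, hb⟩
    obtain ⟨n, hn⟩ := (h (a, b)).1 hb
    exact ⟨Nat.pair (encode b) n, by simpa [r] using hn⟩

theorem REPred.and {p q : α → Prop} (hp : REPred p) (hq : REPred q) :
    REPred fun a => p a ∧ q a := by
  obtain ⟨p', hp', hp⟩ := hp.exists_primrecPred
  obtain ⟨q', hq', hq⟩ := hq.exists_primrecPred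
  have h : PrimrecRel fun (a : α) (n : ℕ) => p' a n.unpair.1 ∧ q' a n.unpair.2 :=
    (hp'.comp Primrec.fst (Primrec.fst.comp (Primrec.unpair.comp Primrec.snd))).and
      (hq'.comp Primrec.fst (Primrec.snd.comp (Primrec.unpair.comp Primrec.snd)))
  refine h.rePred_exists.of_eq fun a => ?_
  rw [hp, hq]
  constructor
  · rintro ⟨n, h₁, h₂⟩
    exact ⟨⟨_, h₁⟩, ⟨_, h₂⟩⟩
  · rintro ⟨⟨m, h₁⟩, ⟨n, h₂⟩⟩
    exact ⟨Nat.pair m n, by simpa using ⟨h₁, h₂⟩⟩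

theorem REPred.or {p q : α → Prop} (hp : REPred p) (hq : REPred q) :
    REPred fun a => p a ∨ q a := by
  obtain ⟨p', hp', hp⟩ := hp.exists_primrecPred
  obtain ⟨q', hq', hq⟩ := hq.exists_primrecPred
  have h : PrimrecRel fun (a : α) n => p' a n ∨ q' a n := PrimrecPred.or hp' hq'
  refine h.rePred_exists.of_eq fun a => ?_
  rw [hp, hq, exists_or]

/-- Finitely many witnesses have a common bound `n`, and once `n` is given both quantifiers are
bounded, hence primitive recursive. -/
theorem REPred.forall_mem_list {p : α → β → Prop} (hp : REPred fun x : α × β => p x.1 x.2)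
    {f : α → List β} (hf : Computable f) : REPred fun a => ∀ b ∈ f a, p a b := by
  obtain ⟨q, hq, h⟩ := hp.exists_primrecPred
  have h₁ : PrimrecRel fun (n : ℕ) (x : β × α) => ∃ m < n, q (x.2, x.1) m := by
    have : PrimrecRel fun m (x : β × α) => q (x.2, x.1) m :=
      hq.comp ((Primrec.snd.comp Primrec.snd).pair (Primrec.fst.comp Primrec.snd)) Primrec.fst
    exact (this.exists_mem_list.comp (Primrec.list_range.comp Primrec.fst)
      Primrec.snd).of_eq fun x => by simp
  have h₂ : PrimrecRel fun (l : List β) (x : α × ℕ) => ∀ b ∈ l, ∃ m < x.2, q (x.1, b) m := by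
    refine PrimrecRel.forall_mem_list (R := fun b (x : α × ℕ) => ∃ m < x.2, q (x.1, b) m) ?_
    exact h₁.comp (Primrec.snd.comp Primrec.snd)
      (Primrec.fst.pair (Primrec.fst.comp Primrec.snd))
  have h₃ : PrimrecRel fun (x : α × List β) (n : ℕ) => ∀ b ∈ x.2, ∃ m < n, q (x.1, b) m :=
    h₂.comp (Primrec.snd.comp Primrec.fst) ((Primrec.fst.comp Primrec.fst).pair Primrec.snd)
  refine (h₃.rePred_exists.comp (Computable.id.pair hf)).of_eq fun a => ?_
  have h : ∀ b, p a b ↔ ∃ n, q (a, b) n := fun b => h (a, b)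
  simp only [id, h]
  constructor
  · rintro ⟨n, hn⟩ b hb
    obtain ⟨m, -, hm⟩ := hn b hb
    exact ⟨m, hm⟩
  · intro H
    choose g hg using H
    clear hf
    generalize f a = l at g hg
    induction l with
    | nil => exact ⟨0, by simp⟩
    | cons b l ih =>
      obtain ⟨n, hn⟩ := ih (fun b hb => g b (List.mem_cons_of_mem _ hb)) fun b hb => hg _ _
      refine ⟨max n (g b List.mem_cons_self + 1), fun c hc => ?_⟩
      rcases List.mem_cons.1 hc with rfl | hc'
      · exact ⟨g c List.mem_cons_self, by lia, hg _ _⟩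
      · obtain ⟨m, hm, hm'⟩ := hn c hc'
        exact ⟨m, by lia, hm'⟩

/-- The s-m-n theorem: the parameter is absorbed into the program by `curry`. -/
theorem REPred.exists_code {p : α → ℕ → Prop} (hp : REPred fun x : α × ℕ => p x.1 x.2) :
    ∃ f : α → ℕ, Computable f ∧ ∀ a, CEAlg.W (f a) = {x | p a x} := by
  obtain ⟨c, hc⟩ := Nat.Partrec.Code.exists_code.1 hp
  refine ⟨fun a => encode (c.curry (encode a)), ?_, fun a => ?_⟩
  · exact (Primrec.encode.comp (Nat.Partrec.Code.primrec₂_curry.comp (Primrec.const c)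
      Primrec.encode)).to_comp
  · ext x
    simp [CEAlg.W, Nat.Partrec.Code.eval_curry, hc, Part.assert]

/-! ### Inductive closure under a recursively enumerable set of rules -/

/-- The smallest set closed under the rules `r`, where `r l x` says that `x` may be inferred from
the list `l` of premises. -/
inductive Inferable {β : Type*} (r : List β → β → Prop) : β → Prop
  | infer (l : List β) (x : β) : r l x → (∀ y ∈ l, Inferable r y) → Inferable r x

open Classical in
/-- The conclusions justified by a list of inference steps. The number in a step bounds the search
for a reason why the rule applies. -/
noncomputable def inferred {β : Type*} (q : List β × β → ℕ → Prop)
    (c : List ((List β × β) × ℕ)) : List β :=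
  -- The fold runs from the right, so a step may use the conclusions of the steps that come after it
  -- in the list.
  c.foldr (fun s known => if q s.1 s.2 ∧ ∀ y ∈ s.1.1, y ∈ known then s.1.2 :: known else known) []

/-- Prefixing steps only enlarges the set of known conclusions, and a larger known set never blocks
a step. Justifications of several premises can therefore be concatenated. -/
theorem mem_inferred_append {β : Type*} {q : List β × β → ℕ → Prop}
    (c d : List ((List β × β) × ℕ)) :
    (∀ y ∈ inferred q c, y ∈ inferred q (c ++ d)) ∧ ∀ y ∈ inferred q d, y ∈ inferred q (c ++ d) := by
  induction c with
  | nil => simp [inferred]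
  | cons s c ih =>
    simp only [inferred, List.foldr_cons, List.cons_append] at ih ⊢
    grind

theorem inferable_iff_exists_inferred {β : Type*} {r : List β → β → Prop}
    {q : List β × β → ℕ → Prop} (h : ∀ s, r s.1 s.2 ↔ ∃ n, q s n) (x : β) :
    Inferable r x ↔ ∃ c, x ∈ inferred q c := by
  constructor
  · intro hx
    induction hx with
    | infer l x hr _ ih =>
      have : ∃ c, ∀ y ∈ l, y ∈ inferred q c := by
        clear hr
        induction l with
        | nil => exact ⟨[], by simp⟩
        | cons y l ihl =>
          obtain ⟨c, hc⟩ := ih y List.mem_cons_self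
          obtain ⟨d, hd⟩ := ihl (fun y hy => by grind) fun y hy => ih y (List.mem_cons_of_mem _ hy)
          refine ⟨c ++ d, fun z hz => ?_⟩
          rcases List.mem_cons.1 hz with rfl | hz
          · exact (mem_inferred_append c d).1 _ hc
          · exact (mem_inferred_append c d).2 _ (hd z hz)
      obtain ⟨c, hc⟩ := this
      obtain ⟨n, hn⟩ := (h (l, x)).1 hr
      refine ⟨((l, x), n) :: c, ?_⟩
      have : inferred q (((l, x), n) :: c) = x :: inferred q c := by
        rw [inferred, List.foldr_cons, if_pos ⟨hn, hc⟩, inferred]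
      simp [this]
  · rintro ⟨c, hc⟩
    induction c generalizing x with
    | nil => simp [inferred] at hc
    | cons s c ih =>
      rw [inferred, List.foldr_cons, ← inferred] at hc
      split_ifs at hc with hs
      · rcases List.mem_cons.1 hc with rfl | hc
        · exact .infer s.1.1 _ ((h s.1).2 ⟨_, hs.1⟩) fun y hy => ih y (hs.2 y hy)
        · exact ih x hc
      · exact ih x hc

/-- A derivation tree flattens to a finite list of steps, each carrying a witness that its rule
applies. Checking such a list is primitive recursive, so only a search for the list remains. -/
theorem REPred.inferable {r : α → List β → β → Prop}
    (hr : REPred fun x : α × List β × β => r x.1 x.2.1 x.2.2) :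
    REPred fun x : α × β => Inferable (r x.1) x.2 := by
  classical
  obtain ⟨q, hq, h⟩ := hr.exists_primrecPred
  have hmem : PrimrecRel fun (y : β) (l : List β) => y ∈ l := by
    have : PrimrecRel fun (l : List β) (y : β) => ∃ z ∈ l, z = y := Primrec.eq.exists_mem_list
    exact (this.comp Primrec.snd Primrec.fst).of_eq fun x => by simp
  have hall : PrimrecRel fun (l k : List β) => ∀ y ∈ l, y ∈ k := hmem.forall_mem_list
  have hinf : Primrec fun x : α × List ((List β × β) × ℕ) => inferred (fun s => q (x.1, s)) x.2 := by
    refine Primrec.list_foldr (h := fun x (s : ((List β × β) × ℕ) × List β) => if q (x.1, s.1.1) s.1.2 ∧ ∀ y ∈ s.1.1.1, y ∈ s.2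
      then s.1.1.2 :: s.2 else s.2) Primrec.snd (Primrec.const []) ?_
    have hs : Primrec fun x : (α × List ((List β × β) × ℕ)) × ((List β × β) × ℕ) × List β =>
        x.2.1 := Primrec.fst.comp Primrec.snd
    have hk : Primrec fun x : (α × List ((List β × β) × ℕ)) × ((List β × β) × ℕ) × List β =>
        x.2.2 := Primrec.snd.comp Primrec.snd
    refine Primrec.ite (PrimrecPred.and ?_ ?_) (Primrec.list_cons.comp ?_ hk) hk
    · exact hq.comp ((Primrec.fst.comp Primrec.fst).pair (Primrec.fst.comp hs))
        (Primrec.snd.comp hs)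
    · exact hall.comp (Primrec.fst.comp (Primrec.fst.comp hs)) hk
    · exact Primrec.snd.comp (Primrec.fst.comp hs)
  have : PrimrecPred fun x : (α × β) × List ((List β × β) × ℕ) =>
      x.1.2 ∈ inferred (fun s => q (x.1.1, s)) x.2 :=
    hmem.comp (Primrec.snd.comp Primrec.fst)
      (hinf.comp ((Primrec.fst.comp Primrec.fst).pair Primrec.snd))
  refine (REPred.exists (p := fun (x : α × β) (c : List ((List β × β) × ℕ)) => x.2 ∈ 
      inferred (fun s => q (x.1, s)) c) this.rePred).of_eq fun x => ?_
  exact (inferable_iff_exists_inferred (fun s => h (x.1, s)) x.2).symm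

end RecursivelyEnumerable

/-! ### Substitutions and surjections between presented algebras -/

namespace CEAlg

open FirstOrder FirstOrder.Language

variable {L : FirstOrder.Language.{u, v}}

theorem subst_subst {X Y Z : Type*} (t : L.Term X) (σ : X → L.Term Y) (τ : Y → L.Term Z) :
    (t.subst σ).subst τ = t.subst fun x => (σ x).subst τ := by
  induction t with
  | var => rfl
  | func f ts ih => simp only [Term.subst, ih]

theorem subst_var {X : Type*} (t : L.Term X) : t.subst .var = t := by
  induction t with
  | var => rfl
  | func f ts ih => simp only [Term.subst, ih]

/-- Only finitely many variables occur in a term. An instance of a law thus depends on a finite list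
of terms, as an inference rule requires. -/
theorem exists_subst_eq_of_forall_lt {X : Type*} (t : L.Term ℕ) :
    ∃ N, ∀ σ τ : ℕ → L.Term X, (∀ i < N, σ i = τ i) → t.subst σ = t.subst τ := by
  induction t with
  | var i => exact ⟨i + 1, fun σ τ h => h i i.lt_succ_self⟩
  | func f ts ih =>
    choose N hN using ih
    refine ⟨Finset.univ.sup N, fun σ τ h => ?_⟩
    simp only [Term.subst]
    congr 1
    exact funext fun i => hN i σ τ fun j hj =>
      h j (hj.trans_le (Finset.le_sup (Finset.mem_univ i)))

variable {Λ : Set (Identity L ℕ)} {X : Type w} {Y Z : Type*}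
  {R : Set (Identity L X)} {R' : Set (Identity L Y)} {R'' : Set (Identity L Z)}

theorem Derivable.of_forall_mem {S : Set (Identity L X)}
    (hR : ∀ s t, (s, t) ∈ R → Derivable Λ S s t) {s t : L.Term X} (h : Derivable Λ R s t) :
    Derivable Λ S s t := by
  induction h with
  | rel h => exact hR _ _ h
  | law σ h => exact .law σ h
  | refl t => exact .refl t
  | symm _ ih => exact ih.symm
  | trans _ _ ih₁ ih₂ => exact ih₁.trans ih₂
  | func f s t _ ih => exact .func f s t ih

theorem Derivable.subst {τ : X → L.Term Y}
    (hτ : ∀ s t, (s, t) ∈ R → Derivable Λ R' (s.subst τ) (t.subst τ)) {s t : L.Term X}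
    (h : Derivable Λ R s t) : Derivable Λ R' (s.subst τ) (t.subst τ) := by
  induction h with
  | rel h => exact hτ _ _ h
  | law σ h =>
    rw [subst_subst, subst_subst]
    exact .law _ h
  | refl t => exact .refl _
  | symm _ ih => exact ih.symm
  | trans _ _ ih₁ ih₂ => exact ih₁.trans ih₂
  | func f s t _ ih => exact .func f _ _ ih

/-- The substitution `τ` induces a surjective homomorphism from `⟨X ∣ R⟩` to `⟨Y ∣ R'⟩`. -/
structure IsEpi (Λ : Set (Identity L ℕ)) (R : Set (Identity L X)) (R' : Set (Identity L Y))
    (τ : X → L.Term Y) : Prop where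
  map_rel : ∀ s t, (s, t) ∈ R → Derivable Λ R' (s.subst τ) (t.subst τ)
  exists_var : ∀ y, ∃ t : L.Term X, Derivable Λ R' (t.subst τ) (.var y)

theorem IsEpi.surjective {τ : X → L.Term Y} (h : IsEpi Λ R R' τ) (t : L.Term Y) :
    ∃ s : L.Term X, Derivable Λ R' (s.subst τ) t := by
  induction t with
  | var y => exact h.exists_var y
  | func f ts ih =>
    choose s hs using ih
    exact ⟨.func f s, .func f _ _ hs⟩

theorem IsEpi.comp {σ : X → L.Term Y} {τ : Y → L.Term Z} (hτ : IsEpi Λ R' R'' τ)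
    (hσ : IsEpi Λ R R' σ) : IsEpi Λ R R'' fun x => (σ x).subst τ where
  map_rel s t h := by
    rw [← subst_subst, ← subst_subst]
    exact (hσ.map_rel s t h).subst hτ.map_rel
  exists_var z := by
    obtain ⟨t, ht⟩ := hτ.exists_var z
    obtain ⟨s, hs⟩ := hσ.surjective t
    exact ⟨s, by rw [← subst_subst]; exact (hs.subst hτ.map_rel).trans ht⟩

/-! ### Consequences of the ascending chain condition -/

variable [L.IsAlgebraic]

/-- A congruence of the term algebra above `≈_R`, as a congruence of `⟨X ∣ R⟩`. -/
def Congruence.quotient (R : Set (Identity L X)) (c : Congruence L (L.Term X))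
    (hc : ∀ s t, Derivable Λ R s t → c.r s t) : Congruence L (PresentedAlgebra Λ R) where
  r := Quotient.lift₂ c.r fun _ _ _ _ h₁ h₂ => propext
    ⟨fun h => c.iseqv.trans (c.iseqv.symm (hc _ _ h₁)) (c.iseqv.trans h (hc _ _ h₂)),
      fun h => c.iseqv.trans (hc _ _ h₁) (c.iseqv.trans h (c.iseqv.symm (hc _ _ h₂)))⟩
  iseqv :=
    ⟨fun a => Quotient.inductionOn a c.iseqv.refl,
      fun {a b} => Quotient.inductionOn₂ a b fun _ _ => c.iseqv.symm,
      fun {a b d} => Quotient.inductionOn₃ a b d fun _ _ _ => c.iseqv.trans⟩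
  map_rel f a b h := by
    induction a using Quotient.induction_on_pi with | _ a
    induction b using Quotient.induction_on_pi with | _ b
    rw [funMap_quotient_mk', funMap_quotient_mk']
    exact c.map_rel f a b h

/-- Congruences of the term algebra above `≈_R` descend to the quotient; this transfers the chain
condition to relations between terms. -/
theorem HasACC.exists_forall_rel_iff (h : HasACC (Congruence L (PresentedAlgebra Λ R)))
    (c : ℕ → Congruence L (L.Term X)) (hc : ∀ n s t, Derivable Λ R s t → (c n).r s t)
    (hmono : ∀ n s t, (c n).r s t → (c (n + 1)).r s t) :
    ∃ n, ∀ m, n ≤ m → ∀ s t, (c m).r s t → (c n).r s t := by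
  obtain ⟨n, hn⟩ := h (fun n => (c n).quotient R (hc n)) fun n a b =>
    Quotient.inductionOn₂ a b (hmono n)
  refine ⟨n, fun m hm s t hst => ?_⟩
  have : ((c n).quotient R (hc n)).r ⟦s⟧ ⟦t⟧ := by
    rw [← hn m hm]
    exact hst
  exact this

/-- With identities numbered by `e`, the members of `R` with number below `n` generate an ascending
chain of congruences; where it stabilizes, finitely many relations already give all of `R`. -/
theorem HasACC.exists_list (h : HasACC (Congruence L (PresentedAlgebra Λ (∅ : Set (Identity L X)))))
    [Countable (Identity L X)] (R : Set (Identity L X)) :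
    ∃ l : List (Identity L X), (∀ p ∈ l, p ∈ R) ∧
      ∀ s t, Derivable Λ R s t → Derivable Λ {p | p ∈ l} s t := by
  obtain ⟨e, he⟩ := exists_injective_nat (Identity L X)
  have hfin : ∀ n, {p | p ∈ R ∧ e p < n}.Finite := fun n =>
    Set.Finite.subset ((Set.finite_Iio n).preimage he.injOn) fun p hp => hp.2
  obtain ⟨n, hn⟩ := h.exists_forall_rel_iff (fun n => presCongruence Λ {p | p ∈ R ∧ e p < n})
    (fun n s t => Derivable.of_forall_mem (by simp))
    (fun n s t => Derivable.of_forall_mem (S := {p | p ∈ R ∧ e p < n + 1}) fun s t h => .rel ⟨h.1, h.2.trans n.lt_succ_self⟩)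
  refine ⟨(hfin n).toFinset.toList, by simp +contextual, fun s t => ?_⟩
  refine Derivable.of_forall_mem fun s t hst => ?_
  have : Derivable Λ {p | p ∈ R ∧ e p < n} s t :=
    -- A stage beyond `n` at which `(s, t)` itself is among the generators.
    hn (max n (e (s, t) + 1)) (le_max_left _ _) s t
      (.rel ⟨hst, (Nat.lt_succ_self _).trans_le (le_max_right _ _)⟩)
  simpa using this

/-- Surjective endomorphisms of an algebra with the ascending chain condition are injective. -/
theorem IsEpi.reflect (h : HasACC (Congruence L (PresentedAlgebra Λ R))) {τ : X → L.Term X}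
    (hτ : IsEpi Λ R R τ) {s t : L.Term X} (hst : Derivable Λ R (s.subst τ) (t.subst τ)) :
    Derivable Λ R s t := by
  let F : L.Term X → L.Term X := fun t => t.subst τ
  have hF : ∀ n s t, Derivable Λ R s t → Derivable Λ R (F^[n] s) (F^[n] t) := by
    intro n
    induction n with
    | zero => exact fun s t h => h
    | succ n ih => exact fun s t h => ih _ _ (h.subst hτ.map_rel)
  have hfunc : ∀ n {k : ℕ} (f : L.Functions k) (ts : Fin k → L.Term X),
      F^[n] (.func f ts) = .func f fun i => F^[n] (ts i) := by
    intro n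
    induction n with
    | zero => exact fun f ts => rfl
    | succ n ih => exact fun f ts => ih f _
  -- The kernels of the iterates of the endomorphism form the ascending chain.
  let c : ℕ → Congruence L (L.Term X) := fun n =>
    { r := fun s t => Derivable Λ R (F^[n] s) (F^[n] t)
      iseqv := ⟨fun _ => .refl _, .symm, .trans⟩
      map_rel := fun f a b h => by
        change Derivable Λ R (F^[n] (.func f a)) (F^[n] (.func f b))
        rw [hfunc, hfunc]
        exact .func f _ _ h }
  obtain ⟨n, hn⟩ := h.exists_forall_rel_iff c hF fun n s t h => by
    change Derivable Λ R (F^[n + 1] s) (F^[n + 1] t)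
    rw [Function.iterate_succ_apply', Function.iterate_succ_apply']
    exact h.subst hτ.map_rel
  have hsurj : ∀ m t, ∃ s, Derivable Λ R (F^[m] s) t := by
    intro m
    induction m with
    | zero => exact fun t => ⟨t, .refl t⟩
    | succ m ih =>
      intro t
      obtain ⟨s, hs⟩ := hτ.surjective t
      obtain ⟨r, hr⟩ := ih s
      refine ⟨r, ?_⟩
      rw [Function.iterate_succ_apply']
      exact (hr.subst hτ.map_rel).trans hs
  -- Both terms are lifted through the `n`-th iterate. The lifts lie in the kernel of iterate `n +
  -- 1`, which equals that of iterate `n`, so `s` and `t` are already identified.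
  obtain ⟨s', hs⟩ := hsurj n s
  obtain ⟨t', ht⟩ := hsurj n t
  refine hs.symm.trans (Derivable.trans ?_ ht)
  refine hn (n + 1) n.le_succ s' t' ?_
  change Derivable Λ R (F^[n + 1] s') (F^[n + 1] t')
  rw [Function.iterate_succ_apply', Function.iterate_succ_apply']
  exact (hs.subst hτ.map_rel).trans (hst.trans (ht.subst hτ.map_rel).symm)

/-- Following `σ` by `τ` gives a surjective endomorphism of `⟨X ∣ R⟩`, hence an injective one, so
the map induced by `σ` is injective. -/
theorem IsEpi.nonempty_equiv (h : HasACC (Congruence L (PresentedAlgebra Λ R)))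
    {σ : X → L.Term Y} (hσ : IsEpi Λ R R' σ) {τ : Y → L.Term X} (hτ : IsEpi Λ R' R τ) :
    Nonempty (PresentedAlgebra Λ R ≃[L] PresentedAlgebra Λ R') := by
  let g : PresentedAlgebra Λ R → PresentedAlgebra Λ R' :=
    Quotient.map (fun t => t.subst σ) fun _ _ h => h.subst hσ.map_rel
  have hg : Function.Bijective g := by
    constructor
    · intro a b
      induction a using Quotient.inductionOn with | _ s
      induction b using Quotient.inductionOn with | _ t
      intro hst
      have hst : Derivable Λ R' (s.subst σ) (t.subst σ) := Quotient.exact hst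
      refine Quotient.sound ((hτ.comp hσ).reflect h ?_)
      rw [← subst_subst, ← subst_subst]
      exact hst.subst hτ.map_rel
    · intro b
      induction b using Quotient.inductionOn with | _ t
      obtain ⟨s, hs⟩ := hσ.surjective t
      exact ⟨⟦s⟧, Quotient.sound hs⟩
  refine ⟨⟨Equiv.ofBijective g hg, fun f x => ?_, fun r => isEmptyElim r⟩⟩
  induction x using Quotient.induction_on_pi with | _ x
  rw [funMap_quotient_mk']
  exact (funMap_quotient_mk' _ f fun i => (x i).subst σ).symm

/-- The substitution picks a representative of the image of each generator. -/
theorem exists_isEpi_of_equiv (e : PresentedAlgebra Λ R ≃[L] PresentedAlgebra Λ R') :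
    ∃ τ, IsEpi Λ R R' τ := by
  choose τ hτ using fun x => Quotient.exists_rep (e ⟦.var x⟧)
  have he : ∀ t : L.Term X, e ⟦t⟧ = ⟦t.subst τ⟧ := by
    intro t
    induction t with
    | var x => exact (hτ x).symm
    | func f ts ih =>
      have h₁ := funMap_quotient_mk' (presCongruence Λ R).toSetoid f ts
      have h₂ := funMap_quotient_mk' (presCongruence Λ R').toSetoid f fun i => (ts i).subst τ
      refine (congrArg e h₁.symm).trans ((e.map_fun f _).trans (Eq.trans ?_ h₂))
      exact congrArg _ (funext ih)
  refine ⟨τ, fun s t h => ?_, fun y => ?_⟩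
  · refine Quotient.exact (s := (presCongruence Λ R').toSetoid) ?_
    rw [← he, ← he]
    exact congrArg e (Quotient.sound (Derivable.rel h))
  · obtain ⟨a, ha⟩ := e.surjective ⟦.var y⟧
    obtain ⟨t, rfl⟩ := Quotient.exists_rep a
    exact ⟨t, Quotient.exact (s := (presCongruence Λ R').toSetoid) ((he t).symm.trans ha)⟩

/-! ### Terms as lists of numbers -/

section Tokens

variable {L : FirstOrder.Language.{u, v}} [Encodable (Σ i, L.Functions i)]
  {X Y : Type*} [Encodable X] [Encodable Y]

/-- Polish notation for terms, with symbols replaced by their Gödel numbers. -/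
def tokens (t : L.Term X) : List ℕ :=
  t.listEncode.map encode

theorem tokens_var (x : X) : tokens (.var x : L.Term X) = [2 * encode x] := by
  simp [tokens, Term.listEncode]

theorem tokens_func {n : ℕ} (f : L.Functions n) (ts : Fin n → L.Term X) :
    tokens (.func f ts) = (2 * encode (⟨n, f⟩ : Σ i, L.Functions i) + 1) ::
      (List.finRange n).flatMap fun i => tokens (ts i) := by
  simp [tokens, Term.listEncode, List.map_flatMap]

theorem tokens_injective : Function.Injective (tokens : L.Term X → List ℕ) := fun _ _ h =>
  Term.listEncode_injective (List.map_injective_iff.2 encode_injective h)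

/-- Passing to tokens does not change Gödel numbers, so the coding of identities and the enumeration
of the laws apply directly to lists of numbers. -/
theorem encode_tokens (t : L.Term X) : encode (tokens t) = encode t := by
  have h : ∀ l : List (X ⊕ Σ i, L.Functions i), encode (l.map encode) = encode l := by
    intro l
    induction l with
    | nil => rfl
    | cons a l ih => simp [ih]
  exact h t.listEncode

/-- Substitution on the level of Polish notation; the default for a missing value is the variable
with number `0`. -/
def substTokens (ts : List (List ℕ)) (u : List ℕ) : List ℕ :=
  -- Even tokens are variables; odd tokens are function symbols and stay.
  u.flatMap fun a => if a % 2 = 0 then ts.getD (a / 2) [0] else [a]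

theorem substTokens_tokens {ts : List (List ℕ)} {σ : X → L.Term Y}
    (h : ∀ x, ts.getD (encode x) [0] = tokens (σ x)) (t : L.Term X) :
    substTokens ts (tokens t) = tokens (t.subst σ) := by
  induction t with
  | var x => simpa [tokens_var, substTokens, Term.subst] using h x
  | @func n f s ih =>
    have : ∀ a, (2 * a + 1) % 2 ≠ 0 := by lia
    simp only [substTokens] at ih
    simp only [Term.subst, tokens_func, substTokens, List.flatMap_cons, if_neg (this _),
      List.singleton_append, List.flatMap_assoc, ih]

theorem primrec_substTokens : Primrec₂ substTokens := by
  refine Primrec.list_flatMap Primrec.snd (Primrec.ite ?_ ?_ ?_)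
  · exact Primrec.eq.comp (Primrec.nat_mod.comp Primrec.snd (Primrec.const 2)) (Primrec.const 0)
  · exact (Primrec.list_getD _).comp (Primrec.fst.comp Primrec.fst)
      (Primrec.nat_div.comp Primrec.snd (Primrec.const 2))
  · exact Primrec.list_cons.comp Primrec.snd (Primrec.const [])

end Tokens

/-! ### An inference system for the valid identities -/

section Rules

variable (L : FirstOrder.Language.{u, v}) [Encodable (Σ i, L.Functions i)]
  [Finite (Σ i, L.Functions i)]

/-- The tokens of the function symbols, paired with their arities. -/
noncomputable def opTokens : List (ℕ × ℕ) :=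
  -- Finiteness of the signature makes this a constant list, so membership is primitive recursive
  -- whatever the encoding of the symbols.
  (Set.finite_range fun f : Σ i, L.Functions i => (2 * encode f + 1, f.1)).toFinset.toList

variable {L}

theorem mem_opTokens {q : ℕ × ℕ} :
    q ∈ opTokens L ↔ ∃ f : L.Functions q.2, 2 * encode (⟨_, f⟩ : Σ i, L.Functions i) + 1 = q.1 := by
  simp only [opTokens, Finset.mem_toList, Set.Finite.mem_toFinset, Set.mem_range]
  constructor
  · rintro ⟨⟨n, f⟩, rfl⟩
    exact ⟨f, rfl⟩
  · rintro ⟨f, hf⟩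
    exact ⟨⟨_, f⟩, Prod.ext hf rfl⟩

/-- The defining relations with index `a`, on the level of Polish notation, where `g` computes the
coding of identities. -/
def RelTokens (g : ℕ × ℕ →. ℕ) (a : ℕ × ℕ) (x : List ℕ × List ℕ) : Prop :=
  ((g (a.1 + 1, encode x)).bind fun c =>
    (Denumerable.ofNat Nat.Partrec.Code a.2).eval c).Dom

/-- The rules of inference for the identities that hold in the algebra with index `a`, on the level
of Polish notation. -/
def Rule (g : ℕ × ℕ →. ℕ) (Λ : Set (Identity L ℕ)) (a : ℕ × ℕ) (l : List (List ℕ × List ℕ))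
    (x : List ℕ × List ℕ) : Prop :=
  (∃ i, i < a.1 + 1 ∧ x = ([2 * i], [2 * i])) ∨
  (∃ q : ℕ × ℕ, q ∈ opTokens L ∧ l.length = q.2 ∧
    x = (q.1 :: l.flatMap Prod.fst, q.1 :: l.flatMap Prod.snd)) ∨
  l = [(x.2, x.1)] ∨
  (∃ b, l = [(x.1, b), (b, x.2)]) ∨
  -- The premises guarantee that both sides are terms; on numbers that code no identity, nothing is
  -- known about `g`.
  (l = [(x.1, x.1), (x.2, x.2)] ∧ RelTokens g a x) ∨
  -- The first components of the premises are the values of the substitution; variables beyond the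
  -- list get the generator with number `0`.
  ∃ y : List ℕ × List ℕ, (∃ p ∈ Λ, encode p = encode y) ∧
    x = (substTokens (l.map Prod.fst) y.1, substTokens (l.map Prod.fst) y.2)

variable {Λ : Set (Identity L ℕ)} {g : ℕ × ℕ →. ℕ}

theorem rePred_rule (hg : Partrec g) (hΛ : CELaws Λ) :
    REPred fun x : (ℕ × ℕ) × List (List ℕ × List ℕ) × (List ℕ × List ℕ) =>
      Rule g Λ x.1 x.2.1 x.2.2 := by
  have ha : Primrec fun x : (ℕ × ℕ) × List (List ℕ × List ℕ) × (List ℕ × List ℕ) => x.1 :=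
    Primrec.fst
  have hl : Primrec fun x : (ℕ × ℕ) × List (List ℕ × List ℕ) × (List ℕ × List ℕ) => x.2.1 :=
    Primrec.fst.comp Primrec.snd
  have hx : Primrec fun x : (ℕ × ℕ) × List (List ℕ × List ℕ) × (List ℕ × List ℕ) => x.2.2 :=
    Primrec.snd.comp Primrec.snd
  have hx₁ := Primrec.fst.comp hx
  have hx₂ := Primrec.snd.comp hx
  have hnil : ∀ {α : Type} [Primcodable α],
      Primrec fun _ : α => ([] : List (List ℕ × List ℕ)) := Primrec.const []
  refine REPred.or ?_ (REPred.or ?_ (REPred.or ?_ (REPred.or ?_ (REPred.or ?_ ?_))))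
  · refine REPred.exists (p := fun (x : (ℕ × ℕ) × List (List ℕ × List ℕ) × (List ℕ × List ℕ))
      (i : ℕ) => i < x.1.1 + 1 ∧ x.2.2 = ([2 * i], [2 * i])) (PrimrecPred.rePred ?_)
    have h : Primrec fun x : ((ℕ × ℕ) × List (List ℕ × List ℕ) × (List ℕ × List ℕ)) × ℕ =>
      [2 * x.2] := Primrec.list_cons.comp (Primrec.nat_double.comp Primrec.snd) (Primrec.const [])
    exact (Primrec.nat_lt.comp Primrec.snd (Primrec.succ.comp (Primrec.fst.comp
      (ha.comp Primrec.fst)))).and (Primrec.eq.comp (hx.comp Primrec.fst) (h.pair h))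
  · refine REPred.exists (p := fun (x : (ℕ × ℕ) × List (List ℕ × List ℕ) × (List ℕ × List ℕ))
      (q : ℕ × ℕ) => q ∈ opTokens L ∧ x.2.1.length = q.2 ∧
        x.2.2 = (q.1 :: x.2.1.flatMap Prod.fst, q.1 :: x.2.1.flatMap Prod.snd))
      (PrimrecPred.rePred ?_)
    have hmem : PrimrecPred fun q : ℕ × ℕ => q ∈ opTokens L := by
      have : PrimrecRel fun (l : List (ℕ × ℕ)) (y : ℕ × ℕ) => ∃ z ∈ l, z = y :=
        Primrec.eq.exists_mem_list
      exact (this.comp (Primrec.const (opTokens L)) Primrec.id).of_eq fun x => by simp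
    have h₁ : Primrec fun l : List (List ℕ × List ℕ) => l.flatMap Prod.fst :=
      Primrec.list_flatMap Primrec.id (Primrec.fst.comp Primrec.snd).to₂
    have h₂ : Primrec fun l : List (List ℕ × List ℕ) => l.flatMap Prod.snd :=
      Primrec.list_flatMap Primrec.id (Primrec.snd.comp Primrec.snd).to₂
    have hq := Primrec.fst.comp (Primrec.snd (α := (ℕ × ℕ) × List (List ℕ × List ℕ) ×
      (List ℕ × List ℕ)) (β := ℕ × ℕ))
    exact (hmem.comp Primrec.snd).and ((Primrec.eq.comp
      (Primrec.list_length.comp (hl.comp Primrec.fst)) (Primrec.snd.comp Primrec.snd)).and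
      (Primrec.eq.comp (hx.comp Primrec.fst)
        ((Primrec.list_cons.comp hq (h₁.comp (hl.comp Primrec.fst))).pair
          (Primrec.list_cons.comp hq (h₂.comp (hl.comp Primrec.fst))))))
  · exact PrimrecPred.rePred (Primrec.eq.comp hl (Primrec.list_cons.comp (hx₂.pair hx₁) hnil))
  · refine REPred.exists (p := fun (x : (ℕ × ℕ) × List (List ℕ × List ℕ) × (List ℕ × List ℕ))
      (b : List ℕ) => x.2.1 = [(x.2.2.1, b), (b, x.2.2.2)]) (PrimrecPred.rePred ?_)
    exact Primrec.eq.comp (hl.comp Primrec.fst) (Primrec.list_cons.comp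
      ((hx₁.comp Primrec.fst).pair Primrec.snd) (Primrec.list_cons.comp
      (Primrec.snd.pair (hx₂.comp Primrec.fst)) hnil))
  · refine REPred.and (PrimrecPred.rePred ?_) (Partrec.dom_re ?_)
    · exact Primrec.eq.comp hl (Primrec.list_cons.comp (hx₁.pair hx₁)
        (Primrec.list_cons.comp (hx₂.pair hx₂) hnil))
    · refine Partrec.bind (hg.comp ((Primrec.succ.comp (Primrec.fst.comp ha)).pair
        (Primrec.encode.comp hx)).to_comp) ?_
      exact Nat.Partrec.Code.eval_part.comp
        (((Primrec.ofNat _).comp (Primrec.snd.comp (ha.comp Primrec.fst))).to_comp)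
        Computable.snd
  · refine REPred.exists (p := fun (x : (ℕ × ℕ) × List (List ℕ × List ℕ) × (List ℕ × List ℕ))
      (y : List ℕ × List ℕ) => (∃ p ∈ Λ, encode p = encode y) ∧
        x.2.2 = (substTokens (x.2.1.map Prod.fst) y.1, substTokens (x.2.1.map Prod.fst) y.2)) ?_
    refine REPred.and (REPred.comp (p := fun c : ℕ => ∃ p ∈ Λ, encode p = c) hΛ
      (Primrec.encode.comp Primrec.snd).to_comp) (PrimrecPred.rePred ?_)
    have h : Primrec fun l : List (List ℕ × List ℕ) => l.map Prod.fst :=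
      Primrec.list_map Primrec.id (Primrec.fst.comp Primrec.snd).to₂
    have h := h.comp (hl.comp Primrec.fst (α := _ × (List ℕ × List ℕ)))
    exact Primrec.eq.comp (hx.comp Primrec.fst)
      ((primrec_substTokens.comp h (Primrec.fst.comp Primrec.snd)).pair
      (primrec_substTokens.comp h (Primrec.snd.comp Primrec.snd)))

/-- Reflexivity is a rule for generators only. With `exists_eq_tokens_of_inferable` as converse,
inferring `(u, u)` is a c.e. test that `u` denotes a term. -/
theorem inferable_tokens_self (a : ℕ × ℕ) (t : L.Term (Fin (a.1 + 1))) :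
    Inferable (Rule g Λ a) (tokens t, tokens t) := by
  induction t with
  | var i =>
    refine .infer [] _ (.inl ⟨i, i.2, ?_⟩) (by simp)
    rw [tokens_var]; rfl
  | @func n f ts ih =>
    refine .infer ((List.finRange n).map fun i => (tokens (ts i), tokens (ts i))) _
      (.inr (.inl ⟨(2 * encode (⟨n, f⟩ : Σ i, L.Functions i) + 1, n), mem_opTokens.2 ⟨f, rfl⟩,
        by simp, ?_⟩)) ?_
    · simp [tokens_func, List.flatMap_map]
    · simpa using ih

theorem inferable_of_derivable {num : IdentityCoding L}
    (hg : ∀ (k : ℕ) (p : Identity L (Fin k)), num.code k p ∈ g (k, encode p)) (a : ℕ × ℕ)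
    {s t : L.Term (Fin (a.1 + 1))} (h : Derivable Λ (num.identities (a.1 + 1) a.2) s t) :
    Inferable (Rule g Λ a) (tokens s, tokens t) := by
  induction h with
  | @rel s t h =>
    refine .infer [(tokens s, tokens s), (tokens t, tokens t)] _
      (.inr (.inr (.inr (.inr (.inl ⟨rfl, ?_⟩))))) ?_
    · have : encode (tokens s, tokens t) = encode (s, t) := by
        simp only [encode_prod_val, encode_tokens]
      rw [RelTokens, this, Part.eq_some_iff.2 (hg _ _), Part.bind_some]
      exact h
    · simp [inferable_tokens_self]
  | @law s t σ h =>
    obtain ⟨M, hM⟩ := exists_subst_eq_of_forall_lt (X := Fin (a.1 + 1)) s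
    obtain ⟨N, hN⟩ := exists_subst_eq_of_forall_lt (X := Fin (a.1 + 1)) t
    -- Truncation leaves both sides of the instance unchanged and agrees with the default `[0]`; the
    -- generator `0` exists because there are `a.1 + 1` of them.
    let τ : ℕ → L.Term (Fin (a.1 + 1)) := fun i => if i < max M N then σ i else .var 0
    rw [hM σ τ (fun i hi => by simp [τ, hi]), hN σ τ (fun i hi => by simp [τ, hi])]
    refine .infer ((List.range (max M N)).map fun i => (tokens (σ i), tokens (σ i))) _
      (.inr (.inr (.inr (.inr (.inr ⟨(tokens s, tokens t), ⟨_, h, ?_⟩, ?_⟩))))) ?_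
    · simp only [encode_prod_val, encode_tokens]
    · have : ∀ i : ℕ, (((List.range (max M N)).map fun i =>
          (tokens (σ i), tokens (σ i))).map Prod.fst).getD (encode i) [0] = tokens (τ i) := by
        intro i
        by_cases hi : i < max M N
        · rw [show τ i = σ i from if_pos hi]
          simp [hi, List.getD_eq_getElem?_getD]
        · rw [show τ i = .var 0 from if_neg hi, tokens_var]
          simp [hi, List.getD_eq_getElem?_getD]
          rfl
      rw [substTokens_tokens this, substTokens_tokens this]
    · simp [inferable_tokens_self]
  | refl t => exact inferable_tokens_self a t
  | symm _ ih => exact .infer _ _ (.inr (.inr (.inl rfl))) (by simpa using ih)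
  | trans _ _ ih₁ ih₂ =>
    exact .infer _ _ (.inr (.inr (.inr (.inl ⟨_, rfl⟩)))) (by simpa using ⟨ih₁, ih₂⟩)
  | @func n f s t _ ih =>
    refine .infer ((List.finRange n).map fun i => (tokens (s i), tokens (t i))) _
      (.inr (.inl ⟨(2 * encode (⟨n, f⟩ : Σ i, L.Functions i) + 1, n), mem_opTokens.2 ⟨f, rfl⟩,
        by simp, ?_⟩)) ?_
    · simp [tokens_func, List.flatMap_map]
    · simpa using ih

/-- Soundness. That the strings denote terms is part of the induction, since the rules speak of
arbitrary lists of numbers. -/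
theorem exists_derivable_of_inferable {num : IdentityCoding L}
    (hg : ∀ (k : ℕ) (p : Identity L (Fin k)), num.code k p ∈ g (k, encode p)) (a : ℕ × ℕ)
    {x : List ℕ × List ℕ} (h : Inferable (Rule g Λ a) x) :
    ∃ s t : L.Term (Fin (a.1 + 1)), x = (tokens s, tokens t) ∧
      Derivable Λ (num.identities (a.1 + 1) a.2) s t := by
  induction h with
  | infer l x hr _ ih =>
    rcases hr with ⟨i, hi, rfl⟩ | ⟨⟨m, n⟩, hq, hn, rfl⟩ | rfl | ⟨b, rfl⟩ | ⟨rfl, hx⟩ |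
      ⟨⟨u, v⟩, ⟨⟨s, t⟩, hst, hy⟩, rfl⟩
    · exact ⟨.var ⟨i, hi⟩, .var ⟨i, hi⟩, by simp only [tokens_var]; rfl, .refl _⟩
    · obtain ⟨f, hf⟩ := mem_opTokens.1 hq
      dsimp only at hn f hf
      subst hn hf
      choose s t hst hd using fun i : Fin l.length => ih l[i] (List.getElem_mem _)
      have hl : l = (List.finRange l.length).map fun i => (tokens (s i), tokens (t i)) := by
        refine List.ext_getElem (by simp) fun i hi _ => ?_
        simpa using hst ⟨i, hi⟩
      refine ⟨.func f s, .func f t, ?_, .func f s t hd⟩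
      have h₁ := congrArg (List.flatMap Prod.fst) hl
      have h₂ := congrArg (List.flatMap Prod.snd) hl
      rw [List.flatMap_map] at h₁ h₂
      rw [tokens_func, tokens_func, h₁, h₂]
    · obtain ⟨s, t, h, hd⟩ := ih (x.2, x.1) (by simp)
      exact ⟨t, s, by grind, hd.symm⟩
    · obtain ⟨s, t, h, hd⟩ := ih (x.1, b) (by simp)
      obtain ⟨s', t', h', hd'⟩ := ih (b, x.2) (by simp)
      simp only [Prod.mk.injEq] at h h'
      -- Unique readability: the middle string of a transitivity step denotes the same term in both
      -- premises.
      obtain rfl := tokens_injective (h.2.symm.trans h'.1)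
      exact ⟨s, t', Prod.ext h.1 h'.2, hd.trans hd'⟩
    · obtain ⟨s, _, h, -⟩ := ih (x.1, x.1) (by simp)
      obtain ⟨t, _, h', -⟩ := ih (x.2, x.2) (by simp)
      obtain rfl : x = (tokens s, tokens t) := by grind
      refine ⟨s, t, rfl, .rel ?_⟩
      have : encode (tokens s, tokens t) = encode (s, t) := by
        simp only [encode_prod_val, encode_tokens]
      rwa [RelTokens, this, Part.eq_some_iff.2 (hg _ _), Part.bind_some] at hx
    · have : ∀ i : ℕ, ∃ r : L.Term (Fin (a.1 + 1)),
          (l.map Prod.fst).getD (encode i) [0] = tokens r := by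
        intro i
        by_cases hi : i < l.length
        · obtain ⟨s, t, h, -⟩ := ih l[i] (List.getElem_mem _)
          exact ⟨s, by simp [List.getD_eq_getElem?_getD, hi, h]⟩
        · refine ⟨.var 0, ?_⟩
          simp [hi, List.getD_eq_getElem?_getD, tokens_var]
          rfl
      choose σ hσ using this
      have hs : encode u = encode (tokens s) ∧ encode v = encode (tokens t) := by
        simpa [encode_tokens, eq_comm] using hy
      rw [encode_injective hs.1, encode_injective hs.2, substTokens_tokens hσ,
        substTokens_tokens hσ]
      exact ⟨_, _, rfl, .law σ hst⟩

theorem exists_eq_tokens_of_inferable {num : IdentityCoding L}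
    (hg : ∀ (k : ℕ) (p : Identity L (Fin k)), num.code k p ∈ g (k, encode p)) {a : ℕ × ℕ}
    {u v : List ℕ} (h : Inferable (Rule g Λ a) (u, v)) :
    ∃ t : L.Term (Fin (a.1 + 1)), u = tokens t := by
  obtain ⟨s, t, h, -⟩ := exists_derivable_of_inferable hg a h
  exact ⟨s, congrArg Prod.fst h⟩

theorem inferable_tokens_iff {num : IdentityCoding L}
    (hg : ∀ (k : ℕ) (p : Identity L (Fin k)), num.code k p ∈ g (k, encode p)) (a : ℕ × ℕ)
    (s t : L.Term (Fin (a.1 + 1))) :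
    Inferable (Rule g Λ a) (tokens s, tokens t) ↔
      Derivable Λ (num.identities (a.1 + 1) a.2) s t := by
  refine ⟨fun h => ?_, inferable_of_derivable hg a⟩
  obtain ⟨s', t', h, hd⟩ := exists_derivable_of_inferable hg a h
  rw [Prod.mk.injEq] at h
  rwa [tokens_injective h.1, tokens_injective h.2]

end Rules

/-! ### The set of finite presentations mapping onto an algebra -/

section Reduction

variable {L : FirstOrder.Language.{u, v}} [Encodable (Σ i, L.Functions i)]
  [Finite (Σ i, L.Functions i)]

/-- The algebra with index `a` is a homomorphic image of the algebra with the finite presentation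
`y`, which consists of the number of generators minus one and of the list of defining relations. -/
def IsImage (g : ℕ × ℕ →. ℕ) (Λ : Set (Identity L ℕ)) (a : ℕ × ℕ)
    (y : ℕ × List (List ℕ × List ℕ)) : Prop :=
  ∃ ts : List (List ℕ), (ts.length = y.1 + 1 ∧ ∀ t ∈ ts, Inferable (Rule g Λ a) (t, t)) ∧
    -- The rules with index `(y.1, 0)` only test whether a string is a term over `y.1 + 1`
    -- generators. This does not depend on the relations, so the second index `0` is arbitrary.
    (∀ x ∈ y.2, Inferable (Rule g Λ (y.1, 0)) (x.1, x.1) ∧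
      Inferable (Rule g Λ (y.1, 0)) (x.2, x.2) ∧
      Inferable (Rule g Λ a) (substTokens ts x.1, substTokens ts x.2)) ∧
    ∀ i ∈ List.range (a.1 + 1), ∃ w, Inferable (Rule g Λ (y.1, 0)) (w, w) ∧
      Inferable (Rule g Λ a) (substTokens ts w, [2 * i])

variable {Λ : Set (Identity L ℕ)} {g : ℕ × ℕ →. ℕ}

theorem rePred_isImage (hg : Partrec g) (hΛ : CELaws Λ) :
    REPred fun x : (ℕ × ℕ) × ℕ × List (List ℕ × List ℕ) => IsImage g Λ x.1 x.2 := by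
  have hI := REPred.inferable (rePred_rule hg hΛ)
  have hI' : ∀ {α : Type} [Primcodable α] {a : α → ℕ × ℕ} {s t : α → List ℕ}, Primrec a →
      Primrec s → Primrec t → REPred fun x => Inferable (Rule g Λ (a x)) (s x, t x) :=
    fun ha hs ht => by
      have h := hI.comp (ha.pair (hs.pair ht)).to_comp
      exact h
  let γ := ((ℕ × ℕ) × ℕ × List (List ℕ × List ℕ)) × List (List ℕ)
  have ha : Primrec fun x : γ => x.1.1 := Primrec.fst.comp Primrec.fst
  have hk : Primrec fun x : γ => x.1.2.1 := Primrec.fst.comp (Primrec.snd.comp Primrec.fst)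
  have hl : Primrec fun x : γ => x.1.2.2 := Primrec.snd.comp (Primrec.snd.comp Primrec.fst)
  have hts : Primrec fun x : γ => x.2 := Primrec.snd
  have hb : Primrec fun x : γ => (x.1.2.1, 0) := hk.pair (Primrec.const 0)
  refine REPred.exists (p := fun (x : (ℕ × ℕ) × ℕ × List (List ℕ × List ℕ))
    (ts : List (List ℕ)) => (ts.length = x.2.1 + 1 ∧
      ∀ t ∈ ts, Inferable (Rule g Λ x.1) (t, t)) ∧
    (∀ z ∈ x.2.2, Inferable (Rule g Λ (x.2.1, 0)) (z.1, z.1) ∧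
      Inferable (Rule g Λ (x.2.1, 0)) (z.2, z.2) ∧
      Inferable (Rule g Λ x.1) (substTokens ts z.1, substTokens ts z.2)) ∧
    ∀ i ∈ List.range (x.1.1 + 1), ∃ w, Inferable (Rule g Λ (x.2.1, 0)) (w, w) ∧
      Inferable (Rule g Λ x.1) (substTokens ts w, [2 * i])) ?_
  refine REPred.and (REPred.and (PrimrecPred.rePred ?_) ?_) (REPred.and ?_ ?_)
  · exact Primrec.eq.comp (Primrec.list_length.comp hts) (Primrec.succ.comp hk)
  · exact REPred.forall_mem_list (p := fun (x : γ) t => Inferable (Rule g Λ x.1.1) (t, t))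
      (hI' (ha.comp Primrec.fst) Primrec.snd Primrec.snd) hts.to_comp
  · refine REPred.forall_mem_list (p := fun (x : γ) (z : List ℕ × List ℕ) =>
      Inferable (Rule g Λ (x.1.2.1, 0)) (z.1, z.1) ∧ Inferable (Rule g Λ (x.1.2.1, 0)) (z.2, z.2) ∧
      Inferable (Rule g Λ x.1.1) (substTokens x.2 z.1, substTokens x.2 z.2)) ?_ hl.to_comp
    have h₁ := Primrec.fst.comp (Primrec.snd (α := γ) (β := List ℕ × List ℕ))
    have h₂ := Primrec.snd.comp (Primrec.snd (α := γ) (β := List ℕ × List ℕ))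
    have h₃ : Primrec fun x : γ × (List ℕ × List ℕ) => substTokens x.1.2 x.2.1 :=
      primrec_substTokens.comp (hts.comp Primrec.fst) h₁
    have h₄ : Primrec fun x : γ × (List ℕ × List ℕ) => substTokens x.1.2 x.2.2 :=
      primrec_substTokens.comp (hts.comp Primrec.fst) h₂
    exact (hI' (hb.comp Primrec.fst) h₁ h₁).and ((hI' (hb.comp Primrec.fst) h₂ h₂).and
      (hI' (ha.comp Primrec.fst) h₃ h₄))
  · refine REPred.forall_mem_list (p := fun (x : γ) (i : ℕ) =>
      ∃ w, Inferable (Rule g Λ (x.1.2.1, 0)) (w, w) ∧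
        Inferable (Rule g Λ x.1.1) (substTokens x.2 w, [2 * i])) ?_
      (Primrec.list_range.comp (Primrec.succ.comp (Primrec.fst.comp ha))).to_comp
    refine REPred.exists (p := fun (x : γ × ℕ) (w : List ℕ) =>
      Inferable (Rule g Λ (x.1.1.2.1, 0)) (w, w) ∧
        Inferable (Rule g Λ x.1.1.1) (substTokens x.1.2 w, [2 * x.2])) ?_
    have h : Primrec fun x : (γ × ℕ) × List ℕ => x.1.1 := Primrec.fst.comp Primrec.fst
    have h' : Primrec fun x : (γ × ℕ) × List ℕ => substTokens x.1.1.2 x.2 :=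
      primrec_substTokens.comp (hts.comp h) Primrec.snd
    exact (hI' (hb.comp h) Primrec.snd Primrec.snd).and
      (hI' (ha.comp h) h'
        (Primrec.list_cons.comp (Primrec.nat_double.comp (Primrec.snd.comp Primrec.fst))
          (Primrec.const [])))

theorem isImage_iff {num : IdentityCoding L}
    (hg : ∀ (k : ℕ) (p : Identity L (Fin k)), num.code k p ∈ g (k, encode p)) (a : ℕ × ℕ)
    (k : ℕ) (y : List (List ℕ × List ℕ)) :
    IsImage g Λ a (k, y) ↔ ∃ l : List (Identity L (Fin (k + 1))),
      y = l.map (Prod.map tokens tokens) ∧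
      ∃ τ, IsEpi Λ {p | p ∈ l} (num.identities (a.1 + 1) a.2) τ := by
  constructor
  · rintro ⟨ts, ⟨hlen, hts⟩, hy, hgen⟩
    dsimp only at hlen hy hgen ⊢
    have hτ : ∀ i : Fin (k + 1), ∃ t : L.Term (Fin (a.1 + 1)),
        ts.getD (encode i) [0] = tokens t := by
      intro i
      have hi : i.1 < ts.length := i.2.trans_eq hlen.symm
      obtain ⟨t, h⟩ := exists_eq_tokens_of_inferable hg (hts _ (List.getElem_mem hi))
      refine ⟨t, ?_⟩
      rw [← h]
      simp [List.getD_eq_getElem?_getD, show encode i = i.1 from rfl, hi]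
    choose τ hτ using hτ
    have hy' : ∀ x ∈ y, ∃ p : Identity L (Fin (k + 1)), Prod.map tokens tokens p = x := by
      intro x hx
      obtain ⟨s, hs⟩ := exists_eq_tokens_of_inferable hg (hy x hx).1
      obtain ⟨t, ht⟩ := exists_eq_tokens_of_inferable hg (hy x hx).2.1
      exact ⟨(s, t), Prod.ext hs.symm ht.symm⟩
    obtain ⟨l, rfl⟩ : ∃ l : List (Identity L (Fin (k + 1))), l.map (Prod.map tokens tokens) = y :=
      (Set.range_list_map _).ge hy'
    refine ⟨l, rfl, τ, fun s t hst => ?_, fun i => ?_⟩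
    · have h := (hy _ (List.mem_map_of_mem hst)).2.2
      simp only [Prod.map_fst, Prod.map_snd, substTokens_tokens hτ] at h
      exact (inferable_tokens_iff hg a _ _).1 h
    · obtain ⟨w, hw, hw'⟩ := hgen i (List.mem_range.2 i.2)
      obtain ⟨t, rfl⟩ := exists_eq_tokens_of_inferable hg hw
      refine ⟨t, (inferable_tokens_iff hg a _ _).1 ?_⟩
      rwa [← substTokens_tokens hτ, tokens_var]
  · rintro ⟨l, rfl, τ, hτ⟩
    have hτ' : ∀ i : Fin (k + 1), ((List.finRange (k + 1)).map fun i => tokens (τ i)).getD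
        (encode i) [0] = tokens (τ i) := by
      intro i
      rw [List.getD_eq_getElem?_getD, show encode i = i.1 from rfl, List.getElem?_map,
        List.getElem?_eq_getElem ((List.length_finRange (n := k + 1)).symm ▸ i.2)]
      simp
    refine ⟨(List.finRange (k + 1)).map fun i => tokens (τ i), ⟨by simp, ?_⟩, ?_, ?_⟩
    · simp [inferable_tokens_self]
    · intro x hx
      obtain ⟨⟨s, t⟩, hst, rfl⟩ := List.mem_map.1 hx
      refine ⟨inferable_tokens_self (k, 0) s, inferable_tokens_self (k, 0) t, ?_⟩
      simp only [Prod.map_fst, Prod.map_snd, substTokens_tokens hτ']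
      exact (inferable_tokens_iff hg a _ _).2 (hτ.map_rel s t hst)
    · intro i hi
      obtain ⟨t, ht⟩ := hτ.exists_var ⟨i, List.mem_range.1 hi⟩
      refine ⟨tokens t, inferable_tokens_self (k, 0) t, ?_⟩
      have h := (inferable_tokens_iff hg a _ _).2 ht
      rwa [tokens_var, ← substTokens_tokens hτ'] at h

end Reduction

/-- It makes the free algebras members of the indexed family, so that the chain condition is
available for them. -/
theorem exists_identities_eq_empty {L : FirstOrder.Language.{u, v}} [Encodable (Σ i, L.Functions i)]
    (num : IdentityCoding L) : ∃ e, ∀ k, num.identities k e = ∅ := by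
  obtain ⟨c, hc⟩ := Nat.Partrec.Code.exists_code.1 Nat.Partrec.none
  refine ⟨encode c, fun k => Set.eq_empty_iff_forall_notMem.2 fun p hp => ?_⟩
  simp [IdentityCoding.identities, W, hc] at hp

end CEAlg

theorem mainTheorem1 {L : FirstOrder.Language.{u, v}} [L.IsAlgebraic]
    [Finite (Σ i, L.Functions i)] [Encodable (Σ i, L.Functions i)]
    (num : CEAlg.IdentityCoding L)
    (Λ : Set (CEAlg.Identity L ℕ)) (hΛ : CEAlg.CELaws Λ)
    (hACC : CEAlg.FGHasACC num Λ) :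
    CEAlg.ComputablyReducible (CEAlg.FGIso num Λ) CEAlg.EqCE := by
  obtain ⟨g, hg, hgnum⟩ := num.computable
  obtain ⟨e, he⟩ := CEAlg.exists_identities_eq_empty num
  have hacc : ∀ a : ℕ × ℕ, CEAlg.HasACC (CEAlg.Congruence L
      (CEAlg.PresentedAlgebra Λ (num.identities (a.1 + 1) a.2))) := fun a => by
    obtain ⟨p, rfl⟩ : ∃ p, Nat.unpair p = a := ⟨_, Nat.unpair_pair a.1 a.2⟩
    exact hACC p
  have hre : REPred fun x : ℕ × ℕ => ∃ y : ℕ × List (List ℕ × List ℕ),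
      CEAlg.IsImage g Λ x.1.unpair y ∧ encode y = x.2 := by
    refine REPred.exists (p := fun (x : ℕ × ℕ) (y : ℕ × List (List ℕ × List ℕ)) =>
      CEAlg.IsImage g Λ x.1.unpair y ∧ encode y = x.2) (REPred.and ?_ (PrimrecPred.rePred ?_))
    · have h : Primrec fun x : (ℕ × ℕ) × ℕ × List (List ℕ × List ℕ) => (x.1.1.unpair, x.2) :=
        (Primrec.unpair.comp (Primrec.fst.comp Primrec.fst)).pair Primrec.snd
      have h' := (CEAlg.rePred_isImage hg hΛ).comp h.to_comp
      exact h'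
    · exact Primrec.eq.comp (Primrec.encode.comp Primrec.snd) (Primrec.snd.comp Primrec.fst)
  obtain ⟨f, hf, hW⟩ := REPred.exists_code (p := fun (p n : ℕ) => ∃ y : ℕ × List (List ℕ × List ℕ),
      CEAlg.IsImage g Λ p.unpair y ∧ encode y = n) hre
  have hmem : ∀ p y, encode y ∈ CEAlg.W (f p) ↔ CEAlg.IsImage g Λ p.unpair y := by
    simp [hW]
  have hepi : ∀ p q, CEAlg.W (f p) ⊆ CEAlg.W (f q) ↔
      ∃ τ, CEAlg.IsEpi Λ (num.identities (p.unpair.1 + 1) p.unpair.2)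
        (num.identities (q.unpair.1 + 1) q.unpair.2) τ := by
    intro p q
    constructor
    · intro h
      -- The chain condition in the free algebra on the generators of `p` yields a finite list `l`
      -- that implies all relations of `p`.
      have hA := hacc (p.unpair.1, e)
      rw [he] at hA
      obtain ⟨l, hl, hd⟩ := hA.exists_list (num.identities (p.unpair.1 + 1) p.unpair.2)
      have hp : CEAlg.IsImage g Λ p.unpair
          (p.unpair.1, l.map (Prod.map CEAlg.tokens CEAlg.tokens)) := by
        -- As `l` consists of relations of `p`, the identity substitution is a surjection.
        refine (CEAlg.isImage_iff hgnum _ _ _).2 ⟨l, rfl, .var, fun s t hst => ?_, fun i => ?_⟩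
        · rw [CEAlg.subst_var, CEAlg.subst_var]
          exact .rel (hl _ hst)
        · exact ⟨.var i, .refl _⟩
      obtain ⟨l', hl', τ, hτ⟩ := (CEAlg.isImage_iff hgnum _ _ _).1 ((hmem q _).1
        (h ((hmem p _).2 hp)))
      obtain rfl : l = l' := List.map_injective_iff.2
        (CEAlg.tokens_injective.prodMap CEAlg.tokens_injective) hl'
      -- The surjection from the algebra presented by `l` respects every relation of `p`, since each
      -- follows from `l`.
      exact ⟨τ, fun s t hst => (hd s t (.rel hst)).subst hτ.map_rel, hτ.exists_var⟩
    · rintro ⟨τ, hτ⟩ n hn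
      rw [hW] at hn ⊢
      obtain ⟨⟨k, y⟩, hy, rfl⟩ := hn
      refine ⟨(k, y), ?_, rfl⟩
      obtain ⟨l, hl, σ, hσ⟩ := (CEAlg.isImage_iff hgnum _ _ _).1 hy
      exact (CEAlg.isImage_iff hgnum _ _ _).2 ⟨l, hl, _, hτ.comp hσ⟩
  refine ⟨f, hf, fun p q => ⟨?_, fun h => ?_⟩⟩
  · rintro ⟨i⟩
    exact Set.Subset.antisymm ((hepi p q).2 (CEAlg.exists_isEpi_of_equiv i))
      ((hepi q p).2 (CEAlg.exists_isEpi_of_equiv i.symm))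
  · obtain ⟨σ, hσ⟩ := (hepi p q).1 h.subset
    obtain ⟨τ, hτ⟩ := (hepi q p).1 h.superset
    exact hσ.nonempty_equiv (hACC p) hτ
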